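/- For $j\in\{0,\tfrac12,1,\tfrac32,\dots\}$ let $V^j$ be the spin-$j$ irreducible representation of $\mathrm{SU}(2)$, of dimension $2j+1$ (realized on homogeneous polynomials of degree $2j$ in two complex variables). Fix a spin $s\in\{0,\tfrac12,1,\dots\}$ and an integer $n\ge 0$. Let ${\rm RW}^{(s)}_n(x)$, for $x\in\tfrac12\mathbb Z$, be the number of walks of $n$ steps that start at $0$, end at $x$, and have every jump in $\{-s,-s+1,\dots,s\}$. Let ${\rm RWM}^{(s)}_n(x)$ be the number of those among them that respect the wall (mirror) at $0$: from a spot $y\ge 0$ the walk may go, in one step, exactly to the spots $|y-s|,|y-s|+1,\dots,y+s$. (i) As a representation of $\mathrm{SU}(2)$, $(V^s)^{\otimes n}\cong\bigoplus_{j} d_j\,V^j$ holds for non-negative integers $d_j$ if and only if $d_j={\rm RWM}^{(s)}_n(j)$ for all $j\in\{0,\tfrac12,1,\dots\}$. That is, the degeneracy ${}^s d^{(n)}_j$ of $V^j$ in $(V^s)^{\otimes n}$ is well defined and equals ${\rm RWM}^{(s)}_n(j)$. (ii) For all $j\in\{0,\tfrac12,1,\dots\}$, ${\rm RWM}^{(s)}_n(j)={\rm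 RW}^{(s)}_n(j)-{\rm RW}^{(s)}_n(j+1)$. (iii) If $s$ is an integer, then for all $j\in\mathbb Z$ $${\rm RW}^{(s)}_n(j)=\frac1{2\pi}\int_{-\pi}^{\pi}e^{-ij\theta}\left(e^{-is\theta}+e^{-i(s-1)\theta}+\dots+1+\dots+e^{is\theta}\right)^n d\theta .$$ (iv) If $s$ is a half-integer ($2s$ odd), then for all $j\in\tfrac12\mathbb Z$ $${\rm RW}^{(s)}_n(j)=\frac1{2\pi}\int_{-\pi}^{\pi}e^{-i(2j)\theta}\left(e^{-i(2s)\theta}+e^{-i(2s-2)\theta}+\dots+e^{-i\theta}+e^{i\theta}+\dots+e^{i(2s)\theta}\right)^n d\theta .$$ -/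

import Mathlib

open scoped TensorProduct DirectSum

noncomputable section

namespace SpinWalk

/-- The group `SU(2)`. -/
abbrev SU2 : Type := Matrix.specialUnitaryGroup (Fin 2) ℂ

/-- The linear substitution `X_i ↦ ∑ k, g k i • X k` on complex polynomials in two variables: the
algebra endomorphism extending the fundamental action of `g` on the span `ℂ²` of the variables. -/
def substAlgHom (g : Matrix (Fin 2) (Fin 2) ℂ) :
    MvPolynomial (Fin 2) ℂ →ₐ[ℂ] MvPolynomial (Fin 2) ℂ :=
  MvPolynomial.aeval fun i => ∑ k, MvPolynomial.C (g k i) * MvPolynomial.X k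

theorem substAlgHom_one : substAlgHom 1 = AlgHom.id ℂ _ := by
  apply MvPolynomial.algHom_ext
  intro i
  fin_cases i <;> simp [substAlgHom]

theorem substAlgHom_mul (g h : Matrix (Fin 2) (Fin 2) ℂ) :
    substAlgHom (g * h) = (substAlgHom g).comp (substAlgHom h) := by
  apply MvPolynomial.algHom_ext
  intro i
  fin_cases i <;> simp [substAlgHom, Matrix.mul_apply, MvPolynomial.algebraMap_eq] <;> ring

/-- The action of `SU(2)` on all complex polynomials in two variables. -/
def polyRep : Representation ℂ SU2 (MvPolynomial (Fin 2) ℂ) where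
  toFun g := (substAlgHom g.1).toLinearMap
  map_one' := by
    rw [show ((1 : SU2).1) = 1 from rfl, substAlgHom_one]; rfl
  map_mul' g h := by
    rw [show ((g * h : SU2).1) = g.1 * h.1 from rfl, substAlgHom_mul]; rfl

/-- The space `V^j`, `j = b / 2`: homogeneous complex polynomials of degree `b = 2j` in two
variables (of dimension `2j + 1`). -/
abbrev SpinSpace (b : ℕ) : Type := MvPolynomial.homogeneousSubmodule (Fin 2) ℂ b

/-- The spin-`j` representation of `SU(2)` on `V^j`, indexed by `b = 2j`. -/
def spinRep (b : ℕ) : Representation ℂ SU2 (SpinSpace b) :=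
  polyRep.subrepresentation (MvPolynomial.homogeneousSubmodule (Fin 2) ℂ b) (by
    intro g p hp
    have h := (show p.IsHomogeneous b from hp).aeval
      (fun i => ∑ k, MvPolynomial.C (g.1 k i) * MvPolynomial.X k) (n := 1) (fun i =>
        MvPolynomial.IsHomogeneous.sum _ _ _ fun k _ => by
          simpa using (MvPolynomial.isHomogeneous_C (Fin 2) (g.1 k i)).mul
            (MvPolynomial.isHomogeneous_X ℂ k))
    rw [one_mul] at h
    exact h)

/-- The `n`-th tensor power `ρ^{⊗ n}` of a representation, `g` acting as `ρ g ⊗ ⋯ ⊗ ρ g`. -/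
def tensorPowerRep {G V : Type*} [Monoid G] [AddCommGroup V] [Module ℂ V]
    (ρ : Representation ℂ G V) (n : ℕ) : Representation ℂ G (⨂[ℂ] _i : Fin n, V) where
  toFun g := PiTensorProduct.map fun _ => ρ g
  map_one' := by
    simp only [map_one]
    exact PiTensorProduct.map_one
  map_mul' g h := by
    simp only [map_mul]
    exact PiTensorProduct.map_mul (fun _ => ρ g) (fun _ => ρ h)

/-- The representation `⨁_j d_j V^j` of `SU(2)`: the direct sum over all `b = 2j` of `d b` copies
of `V^{b/2}`. -/
def spinSumRep (d : ℕ → ℕ) :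
    Representation ℂ SU2 (⨁ p : (Σ b : ℕ, Fin (d b)), SpinSpace p.1) :=
  Representation.directSum fun p : (Σ b : ℕ, Fin (d b)) => spinRep p.1

/-- `W ≅ ⨁_j d_j V^j` as representations of `SU(2)`: the degeneracy of `V^{b/2}` in a
decomposition of `W` into spin representations is `d b`. -/
def HasDegeneracies {W : Type*} [AddCommGroup W] [Module ℂ W]
    (ρ : Representation ℂ SU2 W) (d : ℕ → ℕ) : Prop :=
  Nonempty (ρ.Equiv (spinSumRep d))

end SpinWalk

end

namespace SpinWalk

/-! Walks start at the origin. All spots and jumps are in units of one half, so that `x : ℤ` is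
the spot `x / 2` and the jumps `-s, -s+1, …, s` are `-a, -a+2, …, a` with `a = 2s`. -/

/-- A sequence of `n` jumps, each chosen among the `2s + 1 = a + 1` jumps `-s, -s+1, …, s`:
`w i = m` encodes the jump `2m - a`. -/
abbrev Jumps (a n : ℕ) : Type := Fin n → Fin (a + 1)

/-- The spot reached after the first `t` jumps. -/
def pos {a n : ℕ} (w : Jumps a n) (t : ℕ) : ℤ :=
  ∑ i : Fin n, if (i : ℕ) < t then 2 * ((w i : ℕ) : ℤ) - a else 0

/-- The walk respects the wall at `0`: a step from the spot `x` leads to one of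
`|x - s|, |x - s| + 1, …, x + s`. Hence all jumps are allowed when `x ≥ s`, and only those to a
spot at least `s - x` when `x < s`. -/
def RespectsWall {a n : ℕ} (w : Jumps a n) : Prop :=
  ∀ i : Fin n, |pos w i - a| ≤ pos w (i + 1)

instance {a n : ℕ} (w : Jumps a n) : Decidable (RespectsWall w) :=
  inferInstanceAs (Decidable (∀ i : Fin n, |pos w i - a| ≤ pos w (i + 1)))

/-- The number of returns to the spot `x / 2` after `n` iterations of the free walk with jumps of
length up to `s = a / 2`, starting at the origin. -/
def RW (a n : ℕ) (x : ℤ) : ℕ :=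
  (Finset.univ.filter fun w : Jumps a n => pos w n = x).card

/-- The number of returns to the spot `x / 2` after `n` iterations of the walk with jumps of
length up to `s = a / 2` and a wall at `0`, starting at the origin. -/
def RWM (a n : ℕ) (x : ℤ) : ℕ :=
  (Finset.univ.filter fun w : Jumps a n => RespectsWall w ∧ pos w n = x).card

end SpinWalk

/-! Degeneracies are read off from weights. A torus element `diag(u, u⁻¹)` with `u` of infinite
order acts diagonally on the monomial basis of each spin space. On the `n`-th tensor power its
eigenbasis is indexed by jump sequences, and the eigenvalue is `u` to the endpoint of the walk, so
the multiplicity of weight `k` is `RW a n k`. In a sum of spin representations, `V^{b/2}` carries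
each weight `-b, -b+2, …, b` once, so the multiplicities of `k` and `k + 2` differ by exactly `d k`
(`card_weight`). Hence any decomposition has `d k = RW a n k - RW a n (k + 2)`
(`HasDegeneracies.RW_eq`); Schur's lemma is not needed.

Existence of a decomposition rests on `clebschGordan`: polarization and multiplication by the
invariant `X₀ ⊗ X₁ - X₁ ⊗ X₀` together identify `V^{(a+b+2)/2} ⊕ V^{a/2} ⊗ V^{b/2}` with
`V^{(a+1)/2} ⊗ V^{(b+1)/2}`. Iterating it splits every tensor product of spin representations.

The same difference of free walks counts walks with a wall, by a reflection argument on the last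
jump (`RWM_eq_RW_sub_RW`). The integrals extract a coefficient of the generating function of one
jump, raised to the power `n`, by orthogonality of characters of the circle. -/

namespace Representation

/-! ### Functoriality of direct sums, products and tensor products of representations -/

section
variable {k G : Type*} [CommSemiring k] [Monoid G]
variable {ι κ : Type*} {V W : ι → Type*}
variable [∀ i, AddCommMonoid (V i)] [∀ i, Module k (V i)]
variable [∀ i, AddCommMonoid (W i)] [∀ i, Module k (W i)]

/-- The direct sum of a family of equivalences of representations. -/
noncomputable def directSumCongr {ρ : ∀ i, Representation k G (V i)}
    {σ : ∀ i, Representation k G (W i)} (e : ∀ i, (ρ i).Equiv (σ i)) :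
    (directSum ρ).Equiv (directSum σ) :=
  Equiv.mk (DFinsupp.mapRange.linearEquiv fun i => (e i).toLinearEquiv) (by
    intro g
    refine LinearMap.ext fun x => DFinsupp.ext fun i => ?_
    exact IntertwiningMap.isIntertwining _ _ (e i).toIntertwiningMap g (x i))

/-- Reindexing a direct sum of representations. -/
noncomputable def directSumReindex (ρ : ∀ i, Representation k G (V i)) (h : ι ≃ κ) :
    (directSum ρ).Equiv (directSum fun j => ρ (h.symm j)) :=
  Equiv.mk (DirectSum.lequivCongrLeft k h) (by
    intro g
    refine LinearMap.ext fun x => DFinsupp.ext fun j => ?_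
    rfl)

/-- A direct sum indexed by `Option ι` splits off its summand at `none`. -/
noncomputable def directSumOption {V : Option ι → Type*}
    [∀ i, AddCommMonoid (V i)] [∀ i, Module k (V i)] (ρ : ∀ i, Representation k G (V i)) :
    (directSum ρ).Equiv ((ρ none).prod (directSum fun i => ρ (some i))) :=
  Equiv.mk (DirectSum.lequivProdDirectSum k) (by
    intro g
    refine LinearMap.ext fun x => Prod.ext ?_ (DFinsupp.ext fun j => ?_) <;> rfl)

/-- The iterated direct sum of a family of families of representations. -/
noncomputable def directSumSigma {α : ι → Type*} {V : ∀ i, α i → Type*}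
    [∀ i j, AddCommMonoid (V i j)] [∀ i j, Module k (V i j)]
    (ρ : ∀ i j, Representation k G (V i j)) :
    (directSum fun p : Σ i, α i => ρ p.1 p.2).Equiv (directSum fun i => directSum (ρ i)) := by
  classical
  exact Equiv.mk (DirectSum.sigmaLcurryEquiv k) (by
    intro g
    refine LinearMap.ext fun x => DFinsupp.ext fun i => DFinsupp.ext fun j => ?_
    rfl)

end

section
variable {k G : Type*} [CommSemiring k] [Monoid G]
variable {ι V W V' W' : Type*} {U : ι → Type*}
variable [AddCommMonoid V] [Module k V] [AddCommMonoid W] [Module k W]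
variable [AddCommMonoid V'] [Module k V'] [AddCommMonoid W'] [Module k W']
variable [∀ i, AddCommMonoid (U i)] [∀ i, Module k (U i)]

/-- The tensor product of two equivalences of representations. -/
noncomputable def tprodCongr {ρ : Representation k G V} {ρ' : Representation k G V'}
    {σ : Representation k G W} {σ' : Representation k G W'} (e : ρ.Equiv ρ') (f : σ.Equiv σ') :
    (ρ.tprod σ).Equiv (ρ'.tprod σ') :=
  Equiv.mk (TensorProduct.congr e.toLinearEquiv f.toLinearEquiv) (by
    intro g
    refine TensorProduct.ext' fun x y => ?_
    have h₁ := IntertwiningMap.isIntertwining _ _ e.toIntertwiningMap g x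
    have h₂ := IntertwiningMap.isIntertwining _ _ f.toIntertwiningMap g y
    simp only [LinearMap.comp_apply, tprod_apply, TensorProduct.map_tmul]
    exact congrArg₂ (fun a b => a ⊗ₜ[k] b) h₁ h₂)

/-- The tensor product distributes over a direct sum of representations. -/
noncomputable def directSumTprod (ρ : ∀ i, Representation k G (U i)) (σ : Representation k G W) :
    ((directSum ρ).tprod σ).Equiv (directSum fun i => (ρ i).tprod σ) := by
  classical
  exact Equiv.mk (TensorProduct.directSumLeft k k U W) (by
    intro g
    refine TensorProduct.ext (DirectSum.linearMap_ext k fun i => LinearMap.ext fun x =>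
      LinearMap.ext fun y => ?_)
    simp)

/-- The product of two equivalences of representations. -/
noncomputable def prodCongr {ρ : Representation k G V} {ρ' : Representation k G V'}
    {σ : Representation k G W} {σ' : Representation k G W'} (e : ρ.Equiv ρ') (f : σ.Equiv σ') :
    (ρ.prod σ).Equiv (ρ'.prod σ') :=
  Equiv.mk (LinearEquiv.prodCongr e.toLinearEquiv f.toLinearEquiv) (by
    intro g
    refine LinearMap.ext fun x => Prod.ext ?_ ?_
    · exact IntertwiningMap.isIntertwining _ _ e.toIntertwiningMap g x.1
    · exact IntertwiningMap.isIntertwining _ _ f.toIntertwiningMap g x.2)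

end

end Representation

/-! ### Finite direct sums of spin representations -/

namespace SpinWalk

open Representation

/-- `ρ` is a finite direct sum of spin representations. -/
def IsSpinSum {W : Type*} [AddCommMonoid W] [Module ℂ W] (ρ : Representation ℂ SU2 W) : Prop :=
  ∃ (ι : Type) (_ : Finite ι) (f : ι → ℕ),
    Nonempty (ρ.Equiv (directSum fun i => spinRep (f i)))

variable {W W' : Type*} [AddCommMonoid W] [Module ℂ W] [AddCommMonoid W'] [Module ℂ W']
  {ρ : Representation ℂ SU2 W} {σ : Representation ℂ SU2 W'}

theorem IsSpinSum.of_equiv (h : IsSpinSum σ) (e : ρ.Equiv σ) : IsSpinSum ρ := by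
  obtain ⟨ι, hι, f, ⟨e'⟩⟩ := h
  exact ⟨ι, hι, f, ⟨e.trans e'⟩⟩

theorem IsSpinSum.spinRep_prod (h : IsSpinSum ρ) (c : ℕ) : IsSpinSum ((spinRep c).prod ρ) := by
  obtain ⟨ι, hι, f, ⟨e⟩⟩ := h
  -- With one family `u` on `Option ι`, both summands are definitionally values of the family
  -- `spinRep (u o)`, so no transport is needed.
  have key : ∀ u : Option ι → ℕ,
      IsSpinSum ((spinRep (u none)).prod (directSum fun i => spinRep (u (some i)))) := by
    intro u
    have e := (directSumOption fun o : Option ι => spinRep (u o)).symm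
    exact ⟨Option ι, inferInstance, u, ⟨e⟩⟩
  have h : IsSpinSum ((spinRep c).prod (directSum fun i => spinRep (f i))) :=
    key fun o => o.elim c f
  exact h.of_equiv (prodCongr (Representation.Equiv.refl (spinRep c)) e)

theorem isSpinSum_spinRep (c : ℕ) : IsSpinSum (spinRep c) := by
  refine ⟨PUnit, inferInstance, fun _ => c, ⟨?_⟩⟩
  refine (Representation.Equiv.mk (DirectSum.lid ℂ (SpinSpace c)) fun g => ?_).symm
  refine LinearMap.ext fun x => ?_
  simp

theorem isSpinSum_directSum {ι : Type} [Finite ι] {V : ι → Type*} [∀ i, AddCommMonoid (V i)]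
    [∀ i, Module ℂ (V i)] {ρ : ∀ i, Representation ℂ SU2 (V i)} (h : ∀ i, IsSpinSum (ρ i)) :
    IsSpinSum (directSum ρ) := by
  choose κ hκ f e using h
  refine ⟨Σ i, κ i, inferInstance, fun p => f p.1 p.2, ⟨?_⟩⟩
  exact (directSumCongr fun i => (e i).some).trans
    (directSumSigma fun i j => spinRep (f i j)).symm

/-- A finite direct sum of spin representations has degeneracies. -/
theorem IsSpinSum.exists_hasDegeneracies {W : Type*} [AddCommGroup W] [Module ℂ W]
    {ρ : Representation ℂ SU2 W} (h : IsSpinSum ρ) : ∃ d, HasDegeneracies ρ d := by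
  obtain ⟨ι, hι, f, ⟨e⟩⟩ := h
  have key : ∀ b, Nonempty ({i // f i = b} ≃ Fin (Nat.card {i // f i = b})) := fun b =>
    ⟨Finite.equivFin _⟩
  let h : ι ≃ Σ b : ℕ, Fin (Nat.card {i // f i = b}) :=
    (Equiv.sigmaFiberEquiv f).symm.trans (Equiv.sigmaCongrRight fun b => Finite.equivFin _)
  have hh : ∀ p, f (h.symm p) = p.1 := fun p =>
    ((Finite.equivFin {i // f i = p.1}).symm p.2).2
  refine ⟨fun b => Nat.card {i // f i = b}, ⟨e.trans ((directSumReindex _ h).trans ?_)⟩⟩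
  exact directSumCongr fun p => Nonempty.some (by rw [hh p]; exact ⟨Representation.Equiv.refl _⟩)

end SpinWalk

/-! ### The Clebsch-Gordan splitting on polynomials -/

namespace SpinWalk

open Representation MvPolynomial

/-- Complex polynomials in two variables. -/
abbrev Poly : Type := MvPolynomial (Fin 2) ℂ

theorem substAlgHom_X (g : Matrix (Fin 2) (Fin 2) ℂ) (i : Fin 2) :
    substAlgHom g (X i) = ∑ k, C (g k i) * X k := by
  simp [substAlgHom]

theorem isHomogeneous_substAlgHom (g : Matrix (Fin 2) (Fin 2) ℂ) {p : Poly} {b : ℕ}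
    (hp : p.IsHomogeneous b) : (substAlgHom g p).IsHomogeneous b := by
  have h := hp.aeval (fun i => ∑ k, C (g k i) * X k) (n := 1) (fun i =>
    IsHomogeneous.sum _ _ _ fun k _ => by
      simpa using (isHomogeneous_C (Fin 2) (g k i)).mul (isHomogeneous_X ℂ k))
  rw [one_mul] at h
  exact h

theorem coe_spinRep (b : ℕ) (g : SU2) (p : SpinSpace b) :
    (spinRep b g p : Poly) = substAlgHom g.1 p := rfl

/-- The monomial `X₀ ^ m * X₁ ^ (b - m)` of `V^{b/2}`. -/
noncomputable def spinMonomial (b : ℕ) (m : Fin (b + 1)) : SpinSpace b :=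
  ⟨X 0 ^ (m : ℕ) * X 1 ^ (b - m : ℕ), by
    have h := (isHomogeneous_X_pow (R := ℂ) (0 : Fin 2) (m : ℕ)).mul
      (isHomogeneous_X_pow (R := ℂ) (1 : Fin 2) (b - m : ℕ))
    rwa [show (m : ℕ) + (b - m) = b by omega] at h⟩

theorem coe_spinMonomial (b : ℕ) (m : Fin (b + 1)) :
    (spinMonomial b m : Poly) =
      monomial (Finsupp.single 0 (m : ℕ) + Finsupp.single 1 (b - m : ℕ)) 1 := by
  change (X 0 ^ (m : ℕ) * X 1 ^ (b - m : ℕ) : Poly) = _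
  rw [X_pow_eq_monomial, X_pow_eq_monomial, monomial_mul, one_mul]

theorem linearIndependent_spinMonomial (b : ℕ) : LinearIndependent ℂ (spinMonomial b) := by
  apply LinearIndependent.of_comp (Submodule.subtype _)
  have h : (Submodule.subtype (homogeneousSubmodule (Fin 2) ℂ b)) ∘ spinMonomial b =
      basisMonomials (Fin 2) ℂ ∘ fun m : Fin (b + 1) =>
        Finsupp.single 0 (m : ℕ) + Finsupp.single 1 (b - m : ℕ) := by
    funext m
    simp [coe_spinMonomial]
  rw [h]
  refine (basisMonomials (Fin 2) ℂ).linearIndependent.comp _ fun m m' hm => ?_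
  have := DFunLike.congr_fun hm 0
  simpa [Fin.ext_iff] using this

theorem span_spinMonomial (b : ℕ) : ⊤ ≤ Submodule.span ℂ (Set.range (spinMonomial b)) := by
  rintro ⟨p, hp⟩ -
  have key : p ∈ (Submodule.span ℂ (Set.range (spinMonomial b))).map (Submodule.subtype _) := by
    rw [p.as_sum]
    refine Submodule.sum_mem _ fun d hd => ?_
    have hdb : d 0 + d 1 = b := by
      have := hp (mem_support_iff.1 hd)
      simpa [Finsupp.weight_apply, Finsupp.sum_fintype] using this
    refine ⟨coeff d p • spinMonomial b ⟨d 0, by omega⟩,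
      Submodule.smul_mem _ _ (Submodule.subset_span ⟨_, rfl⟩), ?_⟩
    have hd' : d = Finsupp.single 0 (d 0) + Finsupp.single 1 (b - d 0) := by
      ext i
      fin_cases i
      · simp
      · simp; omega
    simp only [Submodule.subtype_apply, Submodule.coe_smul, coe_spinMonomial, ← hd']
    simp [smul_monomial]
  obtain ⟨q, hq, rfl⟩ := key
  exact hq

/-- The monomial basis of `V^{b/2}`. -/
noncomputable def spinBasis (b : ℕ) : Module.Basis (Fin (b + 1)) ℂ (SpinSpace b) :=
  Module.Basis.mk (linearIndependent_spinMonomial b) (span_spinMonomial b)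

theorem spinBasis_apply (b : ℕ) (m : Fin (b + 1)) : spinBasis b m = spinMonomial b m := by
  simp [spinBasis]

/-- Projection of a polynomial to its homogeneous component of degree `b`. -/
noncomputable def toSpin (b : ℕ) : Poly →ₗ[ℂ] SpinSpace b :=
  (homogeneousComponent b).codRestrict _ fun p => homogeneousComponent_mem b p

theorem coe_toSpin (b : ℕ) (p : Poly) : (toSpin b p : Poly) = homogeneousComponent b p := rfl

theorem homogeneousComponent_substAlgHom (g : Matrix (Fin 2) (Fin 2) ℂ) (b : ℕ) (p : Poly) :
    homogeneousComponent b (substAlgHom g p) = substAlgHom g (homogeneousComponent b p) := by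
  induction p using MvPolynomial.induction_on' with
  | monomial u a =>
    have h : (monomial u a).IsHomogeneous u.degree := isHomogeneous_monomial a rfl
    rw [homogeneousComponent_of_mem h, homogeneousComponent_of_mem (isHomogeneous_substAlgHom g h)]
    split_ifs <;> simp
  | add p q hp hq => simp only [map_add, hp, hq]

theorem toSpin_spinRep (g : SU2) (b : ℕ) (p : Poly) :
    toSpin b (substAlgHom g.1 p) = spinRep b g (toSpin b p) :=
  Subtype.ext (homogeneousComponent_substAlgHom g.1 b p)

/-- Multiplication by the variable `X i`. -/
noncomputable def mulX (i : Fin 2) (b : ℕ) : SpinSpace b →ₗ[ℂ] SpinSpace (b + 1) :=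
  ((LinearMap.mulLeft ℂ (X i : Poly)).comp (Submodule.subtype _)).codRestrict _ fun p => by
    have := (isHomogeneous_X ℂ i).mul (show (p : Poly).IsHomogeneous b from p.2)
    rwa [add_comm] at this

theorem coe_mulX (i : Fin 2) (b : ℕ) (p : SpinSpace b) : (mulX i b p : Poly) = X i * (p : Poly) := rfl

theorem homogeneousComponent_X_mul_succ (b : ℕ) (i : Fin 2) (p : Poly) :
    homogeneousComponent (b + 1) (X i * p) = X i * homogeneousComponent b p := by
  induction p using MvPolynomial.induction_on' with
  | monomial u a =>
    have h : (monomial u a).IsHomogeneous u.degree := isHomogeneous_monomial a rfl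
    have h' := (isHomogeneous_X ℂ i).mul h
    rw [homogeneousComponent_of_mem h, homogeneousComponent_of_mem h', add_comm 1]
    simp only [add_left_inj]
    split_ifs <;> simp
  | add p q hp hq => simp only [map_add, mul_add, hp, hq]

theorem homogeneousComponent_X_mul_zero (i : Fin 2) (p : Poly) :
    homogeneousComponent 0 (X i * p) = 0 := by
  rw [homogeneousComponent_zero, ← constantCoeff_eq, map_mul, constantCoeff_X, zero_mul, C_0]

/-- The inclusion of `V^{a/2} ⊗ V^{b/2}` into the algebra of tensors of polynomials. -/
noncomputable def tensorIncl (a b : ℕ) : SpinSpace a ⊗[ℂ] SpinSpace b →ₗ[ℂ] Poly ⊗[ℂ] Poly :=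
  TensorProduct.map (Submodule.subtype _) (Submodule.subtype _)

theorem tensorIncl_injective (a b : ℕ) : Function.Injective (tensorIncl a b) :=
  TensorProduct.map_injective_of_flat_flat _ _ (Submodule.subtype_injective _)
    (Submodule.subtype_injective _)

/-- Simultaneous linear substitution in both tensor factors. -/
noncomputable def tensorSubst (g : Matrix (Fin 2) (Fin 2) ℂ) :
    Poly ⊗[ℂ] Poly →ₐ[ℂ] Poly ⊗[ℂ] Poly :=
  Algebra.TensorProduct.map (substAlgHom g) (substAlgHom g)

theorem tensorIncl_tprod (a b : ℕ) (g : SU2) (z : SpinSpace a ⊗[ℂ] SpinSpace b) :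
    tensorIncl a b ((spinRep a).tprod (spinRep b) g z) = tensorSubst g.1 (tensorIncl a b z) := by
  induction z using TensorProduct.induction_on with
  | zero => simp
  | tmul x y => simp [tensorIncl, tensorSubst, coe_spinRep]
  | add x y hx hy => rw [map_add, map_add, hx, hy, map_add, map_add]

/-- The invariant `X₀ ⊗ X₁ - X₁ ⊗ X₀`. -/
noncomputable def detTensor : Poly ⊗[ℂ] Poly := X 0 ⊗ₜ X 1 - X 1 ⊗ₜ X 0

/-- The tensor is antisymmetric in the two variables, so any substitution scales it by its
determinant, which is `1` on `SU(2)`. -/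
theorem tensorSubst_detTensor (g : SU2) : tensorSubst g.1 detTensor = detTensor := by
  have hdet : g.1 0 0 * g.1 1 1 - g.1 0 1 * g.1 1 0 = 1 := by
    rw [← Matrix.det_fin_two]
    exact (Matrix.mem_specialUnitaryGroup_iff.1 g.2).2
  have key : tensorSubst g.1 detTensor =
      (g.1 0 0 * g.1 1 1 - g.1 0 1 * g.1 1 0) • detTensor := by
    simp only [tensorSubst, detTensor, map_sub, Algebra.TensorProduct.map_tmul, substAlgHom_X,
      Fin.sum_univ_two, ← smul_eq_C_mul, TensorProduct.add_tmul, TensorProduct.tmul_add,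
      ← TensorProduct.smul_tmul', TensorProduct.tmul_smul]
    module
  rw [key, hdet, one_smul]

theorem detTensor_ne_zero : detTensor ≠ 0 := by
  intro h
  have h' := congrArg (algebraTensorAlgEquiv ℂ Poly (σ := Fin 2)) h
  simp only [detTensor, map_sub, map_zero, algebraTensorAlgEquiv_tmul] at h'
  have := congrArg (coeff (Finsupp.single 1 1)) h'
  simp [coeff_X, Finsupp.single_left_inj] at this

/-- The tensor square is a polynomial ring over `Poly`. This is what makes multiplication by
`detTensor` injective. -/
instance : IsDomain (Poly ⊗[ℂ] Poly) :=
  (algebraTensorAlgEquiv ℂ Poly (σ := Fin 2)).toMulEquiv.isDomain _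

/-- Multiplication by `X₀ ⊗ X₁ - X₁ ⊗ X₀`. -/
noncomputable def mulDet (a b : ℕ) :
    SpinSpace a ⊗[ℂ] SpinSpace b →ₗ[ℂ] SpinSpace (a + 1) ⊗[ℂ] SpinSpace (b + 1) :=
  TensorProduct.map (mulX 0 a) (mulX 1 b) +
    TensorProduct.map ((-1 : ℂ) • mulX 1 a) (mulX 0 b)

theorem tensorIncl_mulDet (a b : ℕ) (z : SpinSpace a ⊗[ℂ] SpinSpace b) :
    tensorIncl _ _ (mulDet a b z) = detTensor * tensorIncl a b z := by
  induction z using TensorProduct.induction_on with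
  | zero => simp
  | tmul x y =>
    simp only [tensorIncl, mulDet, LinearMap.add_apply, map_add, TensorProduct.map_tmul,
      LinearMap.smul_apply, Submodule.subtype_apply, Submodule.coe_smul, coe_mulX]
    rw [detTensor, sub_mul, Algebra.TensorProduct.tmul_mul_tmul,
      Algebra.TensorProduct.tmul_mul_tmul, neg_one_smul, TensorProduct.neg_tmul, sub_eq_add_neg]
  | add x y hx hy => rw [map_add, map_add, hx, hy, map_add, mul_add]

theorem mulDet_injective (a b : ℕ) : Function.Injective (mulDet a b) := by
  refine (injective_iff_map_eq_zero _).2 fun z hz => tensorIncl_injective a b ?_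
  have h := tensorIncl_mulDet a b z
  rw [hz, map_zero] at h
  rw [map_zero]
  exact (mul_eq_zero.1 h.symm).resolve_left detTensor_ne_zero

theorem mulDet_tprod (a b : ℕ) (g : SU2) (z : SpinSpace a ⊗[ℂ] SpinSpace b) :
    mulDet a b ((spinRep a).tprod (spinRep b) g z) =
      (spinRep (a + 1)).tprod (spinRep (b + 1)) g (mulDet a b z) := by
  apply tensorIncl_injective
  rw [tensorIncl_mulDet, tensorIncl_tprod, tensorIncl_tprod, tensorIncl_mulDet, map_mul,
    tensorSubst_detTensor]

/-- The comultiplication `X i ↦ X i ⊗ 1 + 1 ⊗ X i`. -/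
noncomputable def polyComul : Poly →ₐ[ℂ] Poly ⊗[ℂ] Poly :=
  aeval fun i => X i ⊗ₜ 1 + 1 ⊗ₜ X i

theorem polyComul_substAlgHom (g : Matrix (Fin 2) (Fin 2) ℂ) (p : Poly) :
    polyComul (substAlgHom g p) = tensorSubst g (polyComul p) := by
  have : polyComul.comp (substAlgHom g) = (tensorSubst g).comp polyComul := by
    apply algHom_ext
    intro i
    simp only [AlgHom.comp_apply, substAlgHom_X, Fin.sum_univ_two, ← smul_eq_C_mul, map_add,
      map_smul, polyComul, aeval_X, tensorSubst, Algebra.TensorProduct.map_tmul, map_one,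
      TensorProduct.add_tmul, TensorProduct.tmul_add, ← TensorProduct.smul_tmul',
      TensorProduct.tmul_smul]
    module
  exact DFunLike.congr_fun this p

/-- Polarization `V^{c/2} → V^{a/2} ⊗ V^{b/2}`. -/
noncomputable def polarize (a b c : ℕ) : SpinSpace c →ₗ[ℂ] SpinSpace a ⊗[ℂ] SpinSpace b :=
  (TensorProduct.map (toSpin a) (toSpin b)).comp
    (polyComul.toLinearMap.comp (Submodule.subtype _))

theorem map_toSpin_tensorSubst (a b : ℕ) (g : SU2) (z : Poly ⊗[ℂ] Poly) :
    TensorProduct.map (toSpin a) (toSpin b) (tensorSubst g.1 z) =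
      (spinRep a).tprod (spinRep b) g (TensorProduct.map (toSpin a) (toSpin b) z) := by
  induction z using TensorProduct.induction_on with
  | zero => simp
  | tmul x y => simp [tensorSubst, toSpin_spinRep]
  | add x y hx hy => rw [map_add, map_add, hx, hy, map_add, map_add]

theorem polarize_spinRep (a b c : ℕ) (g : SU2) (p : SpinSpace c) :
    polarize a b c (spinRep c g p) = (spinRep a).tprod (spinRep b) g (polarize a b c p) := by
  simp only [polarize, LinearMap.comp_apply, Submodule.subtype_apply, coe_spinRep,
    AlgHom.toLinearMap_apply, polyComul_substAlgHom, map_toSpin_tensorSubst]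

/-- The product of the bihomogeneous component of bidegree `(a, b)`. -/
noncomputable def mulComponent (a b : ℕ) : Poly ⊗[ℂ] Poly →ₗ[ℂ] Poly :=
  (LinearMap.mul' ℂ Poly).comp
    (TensorProduct.map (homogeneousComponent a) (homogeneousComponent b))

theorem mulComponent_left_succ (a b : ℕ) (i : Fin 2) (z : Poly ⊗[ℂ] Poly) :
    mulComponent (a + 1) b (X i ⊗ₜ 1 * z) = X i * mulComponent a b z := by
  induction z using TensorProduct.induction_on with
  | zero => simp
  | tmul x y => simp [mulComponent, homogeneousComponent_X_mul_succ, mul_assoc]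
  | add x y hx hy => rw [mul_add, map_add, map_add, hx, hy, mul_add]

theorem mulComponent_right_succ (a b : ℕ) (i : Fin 2) (z : Poly ⊗[ℂ] Poly) :
    mulComponent a (b + 1) (1 ⊗ₜ X i * z) = X i * mulComponent a b z := by
  induction z using TensorProduct.induction_on with
  | zero => simp
  | tmul x y => simp [mulComponent, homogeneousComponent_X_mul_succ, mul_left_comm]
  | add x y hx hy => rw [mul_add, map_add, map_add, hx, hy, mul_add]

theorem mulComponent_left_zero (b : ℕ) (i : Fin 2) (z : Poly ⊗[ℂ] Poly) :
    mulComponent 0 b (X i ⊗ₜ 1 * z) = 0 := by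
  induction z using TensorProduct.induction_on with
  | zero => simp
  | tmul x y => simp [mulComponent, homogeneousComponent_X_mul_zero, -homogeneousComponent_zero]
  | add x y hx hy => rw [mul_add, map_add, hx, hy, add_zero]

theorem mulComponent_right_zero (a : ℕ) (i : Fin 2) (z : Poly ⊗[ℂ] Poly) :
    mulComponent a 0 (1 ⊗ₜ X i * z) = 0 := by
  induction z using TensorProduct.induction_on with
  | zero => simp
  | tmul x y => simp [mulComponent, homogeneousComponent_X_mul_zero, -homogeneousComponent_zero]
  | add x y hx hy => rw [mul_add, map_add, hx, hy, add_zero]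

/-- Comultiplication is the substitution of `x + y` in two sets of variables; setting `y = x` in the
part of bidegree `(a, b)` leaves a binomial multiple of the original. Appending a variable to `p`
reproduces Pascal's rule. -/
theorem mulComponent_polyComul (p : Poly) : ∀ a b : ℕ,
    mulComponent a b (polyComul p) = (a + b).choose a • homogeneousComponent (a + b) p := by
  induction p using MvPolynomial.induction_on with
  | C c =>
    intro a b
    have h : polyComul (C c) = C c ⊗ₜ 1 := by
      rw [polyComul, aeval_C, Algebra.TensorProduct.algebraMap_apply]; rfl
    rw [h, mulComponent, LinearMap.comp_apply, TensorProduct.map_tmul, LinearMap.mul'_apply,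
      homogeneousComponent_of_mem (isHomogeneous_C _ c),
      homogeneousComponent_of_mem (isHomogeneous_C _ c),
      homogeneousComponent_of_mem (isHomogeneous_one _ _)]
    -- Both sides vanish unless `a = b = 0`, where the binomial coefficient is `1`.
    rcases a with _ | a <;> rcases b with _ | b <;> simp
  | add p q hp hq =>
    intro a b
    rw [map_add, map_add, hp, hq, map_add, smul_add]
  | mul_X p i hp =>
    intro a b
    have h : polyComul (p * X i) = X i ⊗ₜ 1 * polyComul p + 1 ⊗ₜ X i * polyComul p := by
      rw [map_mul, mul_comm, polyComul, aeval_X, add_mul]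
    rw [h, map_add, mul_comm p]
    rcases a with _ | a <;> rcases b with _ | b
    · simp only [mulComponent_left_zero, mulComponent_right_zero, add_zero,
        homogeneousComponent_X_mul_zero, smul_zero]
    · rw [mulComponent_left_zero, mulComponent_right_succ, hp, zero_add, ← add_assoc,
        homogeneousComponent_X_mul_succ]
      simp
    · rw [mulComponent_right_zero, mulComponent_left_succ, hp, add_zero, add_zero, add_zero,
        homogeneousComponent_X_mul_succ]
      simp
    · rw [mulComponent_left_succ, mulComponent_right_succ, hp, hp,
        show a + 1 + (b + 1) = (a + b + 1) + 1 by ring, homogeneousComponent_X_mul_succ,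
        Nat.choose_succ_succ, add_smul, show a + (b + 1) = a + b + 1 by ring,
        show a + 1 + b = a + b + 1 by ring, mul_smul_comm, mul_smul_comm]

theorem mul_tensorIncl_mulDet (a b : ℕ) (z : SpinSpace a ⊗[ℂ] SpinSpace b) :
    LinearMap.mul' ℂ Poly (tensorIncl _ _ (mulDet a b z)) = 0 := by
  rw [tensorIncl_mulDet, ← Algebra.TensorProduct.lmul'_toLinearMap, AlgHom.toLinearMap_apply,
    map_mul]
  simp [detTensor, mul_comm]

theorem mul_tensorIncl_polarize (a b : ℕ) (p : SpinSpace (a + b)) :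
    LinearMap.mul' ℂ Poly (tensorIncl a b (polarize a b (a + b) p)) =
      (a + b).choose a • (p : Poly) := by
  have h : ∀ z : Poly ⊗[ℂ] Poly, LinearMap.mul' ℂ Poly (tensorIncl a b
      (TensorProduct.map (toSpin a) (toSpin b) z)) = mulComponent a b z := by
    intro z
    induction z using TensorProduct.induction_on with
    | zero => simp
    | tmul x y => simp [tensorIncl, mulComponent, coe_toSpin]
    | add x y hx hy => rw [map_add, map_add, map_add, hx, hy, map_add]
  rw [polarize, LinearMap.comp_apply, h]
  simp only [LinearMap.comp_apply, AlgHom.toLinearMap_apply, mulComponent_polyComul,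
    Submodule.subtype_apply]
  rw [homogeneousComponent_eq_self p.2]

/-- The Clebsch-Gordan map
`V^{(a+b+2)/2} × V^{a/2} ⊗ V^{b/2} → V^{(a+1)/2} ⊗ V^{(b+1)/2}`. -/
noncomputable def clebschGordanMap (a b : ℕ) :
    SpinSpace ((a + 1) + (b + 1)) × (SpinSpace a ⊗[ℂ] SpinSpace b) →ₗ[ℂ]
      SpinSpace (a + 1) ⊗[ℂ] SpinSpace (b + 1) :=
  (polarize (a + 1) (b + 1) _).coprod (mulDet a b)

/-- Multiplying the two tensor factors together kills the image of `mulDet` and recovers the first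
component up to a nonzero binomial coefficient. That component of a kernel element is therefore
zero, and `mulDet` is injective on the rest. -/
theorem clebschGordanMap_injective (a b : ℕ) : Function.Injective (clebschGordanMap a b) := by
  refine (injective_iff_map_eq_zero _).2 fun ⟨p, z⟩ h => ?_
  rw [clebschGordanMap, LinearMap.coprod_apply] at h
  have hp : p = 0 := by
    have h' := congrArg (fun w => LinearMap.mul' ℂ Poly (tensorIncl _ _ w)) h
    simp only [map_add, map_zero, mul_tensorIncl_mulDet, mul_tensorIncl_polarize, add_zero] at h'
    have hc : ((a + 1) + (b + 1)).choose (a + 1) ≠ 0 := (Nat.choose_pos (by omega)).ne'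
    exact Subtype.ext ((smul_eq_zero.1 h').resolve_left hc)
  subst hp
  rw [map_zero, zero_add] at h
  rw [(injective_iff_map_eq_zero _).1 (mulDet_injective a b) z h]
  rfl

theorem _root_.LinearMap.bijective_of_injective_of_card_eq {K V V' ι ι' : Type*} [Field K]
    [AddCommMonoid V] [Module K V] [AddCommMonoid V'] [Module K V'] [Fintype ι] [Fintype ι']
    (b : Module.Basis ι K V) (b' : Module.Basis ι' K V') (h : Fintype.card ι = Fintype.card ι')
    {f : V →ₗ[K] V'} (hf : Function.Injective f) : Function.Bijective f := by
  refine ⟨hf, ?_⟩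
  let g : (ι → K) →ₗ[K] (ι' → K) :=
    b'.equivFun.toLinearMap ∘ₗ f ∘ₗ b.equivFun.symm.toLinearMap
  have hg : Function.Injective g :=
    b'.equivFun.injective.comp (hf.comp b.equivFun.symm.injective)
  have hs : Function.Surjective g :=
    (LinearMap.injective_iff_surjective_of_finrank_eq_finrank (by simp [h])).1 hg
  intro y
  obtain ⟨x, hx⟩ := hs (b'.equivFun y)
  exact ⟨b.equivFun.symm x, b'.equivFun.injective hx⟩

/-- Dimensions agree: `(a + b + 3) + (a + 1)(b + 1) = (a + 2)(b + 2)`. -/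
theorem clebschGordanMap_bijective (a b : ℕ) : Function.Bijective (clebschGordanMap a b) := by
  refine LinearMap.bijective_of_injective_of_card_eq
    ((spinBasis ((a + 1) + (b + 1))).prod ((spinBasis a).tensorProduct (spinBasis b)))
    ((spinBasis (a + 1)).tensorProduct (spinBasis (b + 1))) ?_ (clebschGordanMap_injective a b)
  simp only [Fintype.card_sum, Fintype.card_prod, Fintype.card_fin]
  ring

/-- The splitting of the top component from a product of two spin representations. -/
noncomputable def clebschGordan (a b : ℕ) :
    ((spinRep ((a + 1) + (b + 1))).prod ((spinRep a).tprod (spinRep b))).Equiv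
      ((spinRep (a + 1)).tprod (spinRep (b + 1))) :=
  Representation.Equiv.mk
    (LinearEquiv.ofBijective (clebschGordanMap a b) (clebschGordanMap_bijective a b)) (by
    intro g
    refine LinearMap.ext fun x => ?_
    change clebschGordanMap a b (spinRep _ g x.1, (spinRep a).tprod (spinRep b) g x.2) =
      (spinRep (a + 1)).tprod (spinRep (b + 1)) g (clebschGordanMap a b x)
    simp only [clebschGordanMap, LinearMap.coprod_apply, map_add]
    exact congrArg₂ (· + ·) (polarize_spinRep _ _ _ g x.1) (mulDet_tprod a b g x.2))

end SpinWalk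

/-! ### Tensor powers decompose into spin representations -/

namespace SpinWalk

open Representation MvPolynomial

/-- The constant polynomials. -/
noncomputable def spinConst : ℂ →ₗ[ℂ] SpinSpace 0 :=
  (Algebra.linearMap ℂ Poly).codRestrict _ fun c => isHomogeneous_C (Fin 2) c

theorem spinConst_bijective : Function.Bijective spinConst := by
  refine LinearMap.bijective_of_injective_of_card_eq (Module.Basis.singleton Unit ℂ) (spinBasis 0)
    (by simp) fun x y h => ?_
  exact C_injective (Fin 2) ℂ (congrArg Subtype.val h)

/-- The spin-`0` representation is trivial. -/
noncomputable def trivialEquivSpinRep : (trivial ℂ SU2 ℂ).Equiv (spinRep 0) :=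
  Representation.Equiv.mk (LinearEquiv.ofBijective spinConst spinConst_bijective) (by
    intro g
    refine LinearMap.ext fun c => Subtype.ext ?_
    change C c = substAlgHom g.1 (C c)
    rw [substAlgHom, aeval_C]
    rfl)

/-- `clebschGordan` lowers both degrees by one at the cost of one spin summand, until a factor
becomes trivial. -/
theorem isSpinSum_tprod_spinRep (a b : ℕ) : IsSpinSum ((spinRep a).tprod (spinRep b)) := by
  induction a generalizing b with
  | zero =>
    exact (isSpinSum_spinRep b).of_equiv
      ((tprodCongr trivialEquivSpinRep.symm (Representation.Equiv.refl _)).trans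
        (Representation.TensorProduct.lid ℂ (spinRep b)))
  | succ a ih =>
    cases b with
    | zero =>
      exact (isSpinSum_spinRep (a + 1)).of_equiv
        ((tprodCongr (Representation.Equiv.refl _) trivialEquivSpinRep.symm).trans
          (Representation.TensorProduct.rid ℂ (spinRep (a + 1))))
    | succ b => exact ((ih b).spinRep_prod _).of_equiv (clebschGordan a b).symm

theorem IsSpinSum.tprod_spinRep {W : Type*} [AddCommMonoid W] [Module ℂ W]
    {ρ : Representation ℂ SU2 W} (h : IsSpinSum ρ) (c : ℕ) :
    IsSpinSum (ρ.tprod (spinRep c)) := by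
  obtain ⟨ι, hι, f, ⟨e⟩⟩ := h
  refine (isSpinSum_directSum fun i => isSpinSum_tprod_spinRep (f i) c).of_equiv
    ((tprodCongr e (Representation.Equiv.refl _)).trans (directSumTprod _ _))

section
variable {G V : Type*} [Monoid G] [AddCommGroup V] [Module ℂ V]

theorem tensorPowerRep_tprod (ρ : Representation ℂ G V) (n : ℕ) (g : G) (v : Fin n → V) :
    tensorPowerRep ρ n g (PiTensorProduct.tprod ℂ v) =
      PiTensorProduct.tprod ℂ fun i => ρ g (v i) := by
  simp [tensorPowerRep]

/-- The zeroth tensor power is trivial. -/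
noncomputable def tensorPowerZero (ρ : Representation ℂ G V) :
    (tensorPowerRep ρ 0).Equiv (trivial ℂ G ℂ) :=
  Representation.Equiv.mk (PiTensorProduct.isEmptyEquiv (Fin 0)) (by
    intro g
    refine PiTensorProduct.ext (MultilinearMap.ext fun v => ?_)
    simp [tensorPowerRep_tprod])

/-- The last factor of a tensor power splits off. -/
noncomputable def tensorPowerSucc (ρ : Representation ℂ G V) (n : ℕ) :
    (tensorPowerRep ρ (n + 1)).Equiv ((tensorPowerRep ρ n).tprod ρ) :=
  Representation.Equiv.mk
    ((PiTensorProduct.reindex ℂ (fun _ => V) finSumFinEquiv.symm).trans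
      ((PiTensorProduct.tmulEquiv ℂ V).symm.trans
        (TensorProduct.congr (LinearEquiv.refl ℂ _)
          (PiTensorProduct.subsingletonEquiv (0 : Fin 1))))) (by
    intro g
    refine PiTensorProduct.ext (MultilinearMap.ext fun v => ?_)
    simp [tensorPowerRep_tprod])

end

theorem isSpinSum_tensorPowerRep (a n : ℕ) : IsSpinSum (tensorPowerRep (spinRep a) n) := by
  induction n with
  | zero =>
    exact (isSpinSum_spinRep 0).of_equiv ((tensorPowerZero _).trans trivialEquivSpinRep)
  | succ n ih => exact (ih.tprod_spinRep a).of_equiv (tensorPowerSucc _ n)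

end SpinWalk

/-! ### Weights of a torus element -/

namespace SpinWalk

open Representation MvPolynomial

theorem _root_.Module.End.finrank_eigenspace_of_basis {K V ι : Type*} [Field K] [AddCommGroup V]
    [Module K V] [Finite ι] (b : Module.Basis ι K V) {T : Module.End K V} {c : ι → K}
    (h : ∀ i, T (b i) = c i • b i) (μ : K) :
    Module.finrank K (T.eigenspace μ) = Nat.card {i // c i = μ} := by
  have := Fintype.ofFinite ι
  classical
  have hT : ∀ x i, b.repr (T x) i = c i * b.repr x i := by
    intro x i
    have : (Finsupp.lapply i ∘ₗ b.repr.toLinearMap ∘ₗ T : V →ₗ[K] K) =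
        c i • (Finsupp.lapply i ∘ₗ b.repr.toLinearMap) := by
      refine b.ext fun j => ?_
      simp only [LinearMap.comp_apply, h, LinearMap.smul_apply, map_smul, LinearEquiv.coe_coe,
        Module.Basis.repr_self, Finsupp.lapply_apply, Finsupp.single_apply, smul_eq_mul]
      split_ifs with hij <;> simp [hij]
    exact DFunLike.congr_fun this x
  have hs : T.eigenspace μ = Submodule.span K (Set.range fun i : {i // c i = μ} => b i) := by
    apply le_antisymm
    · intro x hx
      rw [Module.End.mem_eigenspace_iff] at hx
      have : Set.range (fun i : {i // c i = μ} => b i) = b '' {i | c i = μ} := by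
        ext; simp
      rw [this, Module.Basis.mem_span_image]
      intro i hi
      have h1 := hT x i
      rw [hx, map_smul, Finsupp.smul_apply, smul_eq_mul] at h1
      exact (mul_right_cancel₀ (Finsupp.mem_support_iff.1 hi) h1).symm
    · rw [Submodule.span_le]
      rintro _ ⟨i, rfl⟩
      rw [SetLike.mem_coe, Module.End.mem_eigenspace_iff, h, i.2]
  rw [hs, Nat.card_eq_fintype_card]
  exact finrank_span_eq_card (b.linearIndependent.comp _ Subtype.val_injective)

/-- The eigenvalue multiplicities of an endomorphism do not depend on the eigenbasis. -/
theorem _root_.Module.End.card_eigenbasis_eq {K V ι κ : Type*} [Field K] [AddCommMonoid V]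
    [Module K V] [Finite ι] [Finite κ] (b : Module.Basis ι K V) (b' : Module.Basis κ K V)
    {T : Module.End K V} {c : ι → K} {c' : κ → K}
    (h : ∀ i, T (b i) = c i • b i) (h' : ∀ i, T (b' i) = c' i • b' i) (μ : K) :
    Nat.card {i // c i = μ} = Nat.card {i // c' i = μ} := by
  let _ : AddCommGroup V := Module.addCommMonoidToAddCommGroup K
  rw [← Module.End.finrank_eigenspace_of_basis b h, Module.End.finrank_eigenspace_of_basis b' h']

/-- A unit complex number of infinite order. -/
noncomputable def unitPhase : ℂ := Complex.exp Complex.I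

theorem unitPhase_ne_zero : unitPhase ≠ 0 := Complex.exp_ne_zero _

/-- A coincidence of two distinct powers would give `k - l = 2πn` with `n ≠ 0`, making `π` rational.
Eigenvalues thus determine integer weights. -/
theorem unitPhase_zpow_injective : Function.Injective fun k : ℤ => unitPhase ^ k := by
  intro k l h
  simp only [unitPhase, ← Complex.exp_int_mul] at h
  obtain ⟨n, hn⟩ := Complex.exp_eq_exp_iff_exists_int.1 h
  have h1 : (k : ℂ) = l + n * (2 * Real.pi) := by
    apply mul_right_cancel₀ Complex.I_ne_zero
    rw [hn]; ring
  have h2 : (k : ℝ) = l + n * (2 * Real.pi) := by exact_mod_cast h1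
  by_contra hkl
  have hn0 : n ≠ 0 := by
    rintro rfl
    apply hkl
    simpa using h2
  apply irrational_pi
  refine ⟨((k - l : ℤ) : ℚ) / (2 * n : ℤ), ?_⟩
  have : (n : ℝ) ≠ 0 := by exact_mod_cast hn0
  push_cast
  rw [h2]
  field_simp
  ring

/-- The diagonal torus element with eigenvalues `unitPhase` and its inverse. -/
noncomputable def torusElement : SU2 :=
  ⟨Matrix.diagonal ![unitPhase, unitPhase⁻¹], by
    have hs : star unitPhase = unitPhase⁻¹ := by
      rw [unitPhase, ← Complex.exp_neg, Complex.star_def, ← Complex.exp_conj, Complex.conj_I]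
    rw [Matrix.mem_specialUnitaryGroup_iff]
    constructor
    · rw [Matrix.mem_unitaryGroup_iff, Matrix.star_eq_conjTranspose, Matrix.diagonal_conjTranspose,
        Matrix.diagonal_mul_diagonal, ← Matrix.diagonal_one]
      congr 1
      funext i
      fin_cases i
      · simpa [hs] using mul_inv_cancel₀ unitPhase_ne_zero
      · simpa [← hs] using inv_mul_cancel₀ unitPhase_ne_zero
    · simp [Matrix.det_diagonal, unitPhase_ne_zero]⟩

theorem spinRep_torusElement (b : ℕ) (m : Fin (b + 1)) :
    spinRep b torusElement (spinBasis b m) =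
      unitPhase ^ (2 * ((m : ℕ) : ℤ) - b) • spinBasis b m := by
  rw [spinBasis_apply]
  apply Subtype.ext
  rw [coe_spinRep, Submodule.coe_smul]
  change substAlgHom torusElement.1 (X 0 ^ (m : ℕ) * X 1 ^ (b - m : ℕ)) =
    unitPhase ^ (2 * ((m : ℕ) : ℤ) - b) • (X 0 ^ (m : ℕ) * X 1 ^ (b - m : ℕ) : Poly)
  rw [map_mul, map_pow, map_pow, substAlgHom_X, substAlgHom_X, Fin.sum_univ_two, Fin.sum_univ_two]
  have h : unitPhase ^ (2 * ((m : ℕ) : ℤ) - b) =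
      unitPhase ^ (m : ℕ) * (unitPhase⁻¹) ^ (b - m : ℕ) := by
    have hm : (2 * ((m : ℕ) : ℤ) - b) = (m : ℕ) - ((b - m : ℕ) : ℤ) := by omega
    rw [hm, zpow_sub₀ unitPhase_ne_zero, zpow_natCast, zpow_natCast, inv_pow, div_eq_mul_inv]
  rw [h]
  rw [smul_eq_C_mul, C_mul, C_pow, C_pow]
  simp only [torusElement, Matrix.diagonal_apply_eq, Matrix.diagonal_apply_ne _ zero_ne_one,
    Matrix.diagonal_apply_ne _ one_ne_zero, Matrix.cons_val_zero, Matrix.cons_val_one, C_0,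
    zero_mul, add_zero, zero_add, mul_pow]
  ring

theorem tensorPowerRep_torusElement (a n : ℕ) (w : Jumps a n) :
    tensorPowerRep (spinRep a) n torusElement
        (Basis.piTensorProduct (fun _ : Fin n => spinBasis a) w) =
      unitPhase ^ pos w n • Basis.piTensorProduct (fun _ : Fin n => spinBasis a) w := by
  rw [Basis.piTensorProduct_apply, tensorPowerRep_tprod]
  simp only [spinRep_torusElement]
  rw [MultilinearMap.map_smul_univ]
  congr 1
  simp only [pos, Fin.is_lt, if_true]
  symm
  induction (Finset.univ : Finset (Fin n)) using Finset.induction_on with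
  | empty => simp
  | insert i s hi ih =>
    rw [Finset.sum_insert hi, Finset.prod_insert hi, zpow_add₀ unitPhase_ne_zero, ih]

/-- The index set of the weight basis of `⨁_j d_j V^j`. -/
abbrev WeightIndex (d : ℕ → ℕ) : Type := Σ p : (Σ b : ℕ, Fin (d b)), Fin (p.1 + 1)

/-- The weight, in units of one half. -/
def weight {d : ℕ → ℕ} (x : WeightIndex d) : ℤ := 2 * ((x.2 : ℕ) : ℤ) - x.1.1

theorem _root_.DFinsupp.basis_apply {ι R : Type*} {M : ι → Type*} {η : ι → Type*} [Semiring R]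
    [∀ i, AddCommMonoid (M i)] [∀ i, Module R (M i)] [DecidableEq ι]
    (b : ∀ i, Module.Basis (η i) R (M i)) (x : Σ i, η i) :
    DFinsupp.basis b x = DFinsupp.single x.1 (b x.1 x.2) := by
  apply (DFinsupp.basis b).repr.injective
  rw [Module.Basis.repr_self]
  change _ = (sigmaFinsuppLequivDFinsupp R).symm
    (DFinsupp.mapRange (fun i => (b i).repr) (fun i => map_zero _)
      (DFinsupp.single x.1 (b x.1 x.2)))
  rw [DFinsupp.mapRange_single, Module.Basis.repr_self, LinearEquiv.eq_symm_apply]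
  exact sigmaFinsuppEquivDFinsupp_single x 1

/-- The weight basis of `⨁_j d_j V^j`. -/
noncomputable def spinSumBasis (d : ℕ → ℕ) : Module.Basis (WeightIndex d) ℂ
    (⨁ p : (Σ b : ℕ, Fin (d b)), SpinSpace p.1) :=
  DFinsupp.basis fun p => spinBasis p.1

theorem spinSumRep_torusElement (d : ℕ → ℕ) (x : WeightIndex d) :
    spinSumRep d torusElement (spinSumBasis d x) = unitPhase ^ weight x • spinSumBasis d x := by
  have h : spinSumBasis d x =
      DirectSum.lof ℂ _ (fun p : (Σ b : ℕ, Fin (d b)) => SpinSpace p.1) x.1 (spinBasis _ x.2) :=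
    DFinsupp.basis_apply _ x
  rw [h, spinSumRep, directSum_apply, DirectSum.lmap_lof, spinRep_torusElement, map_smul]
  rfl

/-- Lowering by one step inside each summand embeds weight `k + 2` into weight `k`. The vectors
missed are the highest weight vectors of weight `k`, one for each copy of `V^{k/2}`. -/
theorem card_weight (d : ℕ → ℕ) [Finite (WeightIndex d)] (k : ℕ) :
    Nat.card {x : WeightIndex d // weight x = k} =
      Nat.card {x : WeightIndex d // weight x = k + 2} + d k := by
  let f : {x : WeightIndex d // weight x = k + 2} ⊕ Fin (d k) →
      {x : WeightIndex d // weight x = k} :=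
    Sum.elim
      (fun x => ⟨⟨x.1.1, ⟨(x.1.2 : ℕ) - 1, by omega⟩⟩, by
        have h := x.2
        have := x.1.2.is_lt
        simp only [weight] at h ⊢
        omega⟩)
      (fun c => ⟨⟨⟨k, c⟩, Fin.last k⟩, by simp [weight]; ring⟩)
  have hf : Function.Bijective f := by
    constructor
    · rintro (⟨⟨p, m⟩, hx⟩ | c) (⟨⟨q, m'⟩, hy⟩ | c') h
      · simp only [f, Sum.elim_inl, Subtype.mk.injEq, Sigma.mk.injEq] at h
        obtain ⟨rfl, h⟩ := h
        simp only [weight] at hx hy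
        have : m = m' := by ext; omega
        subst this
        rfl
      · exfalso
        simp only [f, Sum.elim_inl, Sum.elim_inr, Subtype.mk.injEq, Sigma.mk.injEq] at h
        obtain ⟨rfl, h⟩ := h
        simp only [weight] at hx
        have := m.is_lt
        simp only at this
        omega
      · exfalso
        simp only [f, Sum.elim_inl, Sum.elim_inr, Subtype.mk.injEq, Sigma.mk.injEq] at h
        obtain ⟨rfl, h⟩ := h
        simp only [weight] at hy
        have := m'.is_lt
        simp only at this
        omega
      · simp only [f, Sum.elim_inr, Subtype.mk.injEq, Sigma.mk.injEq] at h
        simpa using h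
    · rintro ⟨⟨⟨b, c⟩, m⟩, hx⟩
      simp only [weight] at hx
      by_cases hm : (m : ℕ) < b
      · refine ⟨Sum.inl ⟨⟨⟨b, c⟩, ⟨(m : ℕ) + 1, by simp only; omega⟩⟩, ?_⟩, ?_⟩
        · simp only [weight]; push_cast; omega
        · simp [f]
      · have := m.is_lt
        simp only at this
        obtain rfl : b = k := by omega
        refine ⟨Sum.inr c, ?_⟩
        have : m = Fin.last b := by ext; simp only [Fin.val_last]; omega
        subst this
        rfl
  rw [← Nat.card_congr (Equiv.ofBijective f hf), Nat.card_sum, Nat.card_fin]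

theorem RW_eq_card (a n : ℕ) (k : ℤ) :
    RW a n k = Nat.card {w : Jumps a n // unitPhase ^ pos w n = unitPhase ^ k} := by
  rw [RW, Nat.card_eq_fintype_card, Fintype.card_subtype]
  congr 1
  ext w
  simp only [Finset.mem_filter, Finset.mem_univ, true_and]
  exact (unitPhase_zpow_injective.eq_iff (a := pos w n) (b := k)).symm

/-- The degeneracies in a tensor power are differences of numbers of free walks. -/
theorem HasDegeneracies.RW_eq {a n : ℕ} {d : ℕ → ℕ}
    (h : HasDegeneracies (W := ⨂[ℂ] _i : Fin n, SpinSpace a)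
      (tensorPowerRep (spinRep a) n) d) (k : ℕ) :
    RW a n k = RW a n (k + 2) + d k := by
  obtain ⟨e⟩ := h
  let B := Basis.piTensorProduct (fun _ : Fin n => spinBasis a)
  let B' := (spinSumBasis d).map e.symm.toLinearEquiv
  have : Module.Finite ℂ (⨂[ℂ] _i : Fin n, SpinSpace a) := Module.Finite.of_basis B
  have : Finite (WeightIndex d) := Module.Finite.finite_basis B'
  have hB' : ∀ x, tensorPowerRep (spinRep a) n torusElement (B' x) =
      unitPhase ^ weight x • B' x := by
    intro x
    have h1 := IntertwiningMap.isIntertwining _ _ e.symm.toIntertwiningMap torusElement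
      (spinSumBasis d x)
    rw [spinSumRep_torusElement, map_smul] at h1
    exact h1.symm
  -- Both sides are the dimension of the same eigenspace, computed in the eigenbases `B` and `B'`.
  have key : ∀ k : ℤ, RW a n k = Nat.card {x : WeightIndex d // weight x = k} := by
    intro k
    rw [RW_eq_card, Module.End.card_eigenbasis_eq B B' (tensorPowerRep_torusElement a n) hB']
    exact Nat.card_congr (Equiv.subtypeEquivRight fun x =>
      unitPhase_zpow_injective.eq_iff (a := weight x) (b := k))
  rw [key, key, card_weight]

end SpinWalk

/-! ### Recursion on the last jump and the reflection principle -/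

namespace SpinWalk

theorem pos_eq_sum {a n : ℕ} (w : Jumps a n) : pos w n = ∑ i, (2 * ((w i : ℕ) : ℤ) - a) := by
  simp [pos]

theorem pos_snoc {a n : ℕ} (w : Jumps a n) (m : Fin (a + 1)) {t : ℕ} (ht : t ≤ n) :
    pos (Fin.snoc w m : Jumps a (n + 1)) t = pos w t := by
  simp [pos, Fin.sum_univ_castSucc, ht]

theorem pos_snoc_last {a n : ℕ} (w : Jumps a n) (m : Fin (a + 1)) :
    pos (Fin.snoc w m : Jumps a (n + 1)) (n + 1) = pos w n + (2 * ((m : ℕ) : ℤ) - a) := by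
  rw [pos_eq_sum, pos_eq_sum, Fin.sum_univ_castSucc]
  simp

theorem respectsWall_snoc {a n : ℕ} (w : Jumps a n) (m : Fin (a + 1)) :
    RespectsWall (Fin.snoc w m : Jumps a (n + 1)) ↔
      RespectsWall w ∧ |pos w n - a| ≤ pos w n + (2 * ((m : ℕ) : ℤ) - a) := by
  unfold RespectsWall
  rw [Fin.forall_fin_succ']
  refine and_congr (forall_congr' fun i => ?_) ?_
  · rw [Fin.val_castSucc, pos_snoc _ _ i.is_lt.le, pos_snoc _ _ i.is_lt]
  · rw [Fin.val_last, pos_snoc _ _ le_rfl, pos_snoc_last]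

theorem card_filter_jumps_succ {a n : ℕ} (P : Jumps a (n + 1) → Prop) [DecidablePred P] :
    (Finset.univ.filter P).card =
      ∑ m : Fin (a + 1), (Finset.univ.filter fun w : Jumps a n =>
        P (Fin.snoc w m : Jumps a (n + 1))).card := by
  simp only [Finset.card_filter]
  rw [← (Fin.snocEquiv fun _ : Fin (n + 1) => Fin (a + 1)).sum_comp, Fintype.sum_prod_type]
  rfl

theorem RW_zero (a : ℕ) (x : ℤ) : RW a 0 x = if x = 0 then 1 else 0 := by
  simp [RW, pos, Finset.filter_const, eq_comm, apply_ite Finset.card]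

theorem RW_succ (a n : ℕ) (x : ℤ) :
    RW a (n + 1) x = ∑ m ∈ Finset.range (a + 1), RW a n (x - 2 * m + a) := by
  rw [RW, card_filter_jumps_succ, ← Fin.sum_univ_eq_sum_range fun m => RW a n (x - 2 * m + a)]
  refine Finset.sum_congr rfl fun m _ => ?_
  rw [RW]
  congr 1
  ext w
  simp only [Finset.mem_filter, Finset.mem_univ, true_and, pos_snoc_last]
  omega

theorem RWM_zero (a : ℕ) (x : ℤ) : RWM a 0 x = if x = 0 then 1 else 0 := by
  simp [RWM, RespectsWall, pos, Finset.filter_const, eq_comm, apply_ite Finset.card]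

/-- A last jump `2m - a` into `y` starts at `z = y - 2m + a`. The wall condition `|z - a| ≤ y` reads
`|y - 2m| ≤ y`, that is, `m ≤ y`. -/
theorem RWM_succ (a n : ℕ) (y : ℕ) :
    RWM a (n + 1) y = ∑ m ∈ Finset.range (a + 1),
      if m ≤ y then RWM a n ((y : ℤ) - 2 * m + a) else 0 := by
  rw [RWM, card_filter_jumps_succ, ← Fin.sum_univ_eq_sum_range
    fun m => if m ≤ y then RWM a n ((y : ℤ) - 2 * m + a) else 0]
  refine Finset.sum_congr rfl fun m _ => ?_
  simp only [respectsWall_snoc, pos_snoc_last, abs_le]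
  split_ifs with h
  · rw [RWM]
    congr 1
    ext w
    simp only [Finset.mem_filter, Finset.mem_univ, true_and]
    constructor
    · rintro ⟨⟨h1, h2⟩, h3⟩
      exact ⟨h1, by omega⟩
    · rintro ⟨h1, h2⟩
      exact ⟨⟨h1, by omega, by omega⟩, by omega⟩
  · rw [Finset.card_eq_zero, Finset.filter_eq_empty_iff]
    rintro w - ⟨⟨h1, h2⟩, h3⟩
    omega

theorem RW_neg (a n : ℕ) (x : ℤ) : RW a n (-x) = RW a n x := by
  induction n generalizing x with
  | zero => simp [RW_zero]
  | succ n ih =>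
    rw [RW_succ, RW_succ, ← Finset.sum_range_reflect]
    refine Finset.sum_congr rfl fun m hm => ?_
    rw [← ih]
    congr 1
    have := Finset.mem_range.1 hm
    omega

/-- The reflection principle for the walk with a wall. -/
theorem RWM_eq_RW_sub_RW (a n : ℕ) (y : ℕ) :
    (RWM a n y : ℤ) = (RW a n y : ℤ) - RW a n (y + 2) := by
  induction n generalizing y with
  | zero =>
    have : (y : ℤ) + 2 ≠ 0 := by omega
    rw [RWM_zero, RW_zero, RW_zero, if_neg this]
    simp
  | succ n ih =>
    let g : ℕ → ℤ := fun m => (RW a n ((y : ℤ) - 2 * m + a) : ℤ) - RW a n ((y : ℤ) - 2 * m + a + 2)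
    -- Replacing `m` by `y + a + 1 - m` reflects the spots `z` and `z + 2` to `-(z + 2)` and `-z`,
    -- so by the symmetry of the free walk the difference changes sign.
    have hg : ∀ m m' : ℕ, m + m' = y + a + 1 → g m + g m' = 0 := by
      intro m m' h
      have h1 : RW a n ((y : ℤ) - 2 * m' + a) = RW a n ((y : ℤ) - 2 * m + a + 2) := by
        rw [← RW_neg]; congr 1; omega
      have h2 : RW a n ((y : ℤ) - 2 * m' + a + 2) = RW a n ((y : ℤ) - 2 * m + a) := by
        rw [← RW_neg]; congr 1; omega
      simp only [g, h1, h2]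
      ring
    have hR : (RW a (n + 1) y : ℤ) - RW a (n + 1) (y + 2) = ∑ m ∈ Finset.range (a + 1), g m := by
      rw [RW_succ, RW_succ]
      push_cast
      rw [← Finset.sum_sub_distrib]
      refine Finset.sum_congr rfl fun m _ => ?_
      simp only [g]
      congr 3
      ring
    have hM : (RWM a (n + 1) y : ℤ) =
        ∑ m ∈ Finset.range (a + 1), if m ≤ y then g m else 0 := by
      rw [RWM_succ]
      push_cast
      refine Finset.sum_congr rfl fun m hm => ?_
      have := Finset.mem_range.1 hm
      split_ifs with h
      -- Since `m ≤ y` and `m ≤ a`, the previous spot is nonnegative, as the induction hypothesis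
      -- requires.
      · obtain ⟨z, hz⟩ : ∃ z : ℕ, (y : ℤ) - 2 * m + a = z := ⟨y + a - 2 * m, by omega⟩
        simp only [g, hz, ih]
      · rfl
    rw [hR, hM, ← Finset.sum_filter, ← Finset.sum_filter_add_sum_filter_not (Finset.range (a + 1)) (· ≤ y) g,
      left_eq_add]
    -- The terms forbidden by the wall have `y < m ≤ a`. The reflection preserves this range and
    -- cancels them in pairs; at a fixed point `g m = -g m`, so the term is zero.
    refine Finset.sum_involution (fun m _ => y + a + 1 - m) ?_ ?_ ?_ ?_
    · intro m hm
      simp only [Finset.mem_filter, Finset.mem_range] at hm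
      exact hg _ _ (by omega)
    · intro m hm hne heq
      simp only [Finset.mem_filter, Finset.mem_range] at hm
      have := hg m m (by omega)
      omega
    · intro m hm
      simp only [Finset.mem_filter, Finset.mem_range] at hm ⊢
      omega
    · intro m hm
      simp only [Finset.mem_filter, Finset.mem_range] at hm
      omega

/-! ### Fourier integrals for the free walk -/

theorem intervalIntegrable_exp_int_mul (k : ℤ) (c d : ℝ) :
    IntervalIntegrable (fun θ : ℝ => Complex.exp (Complex.I * k * θ)) MeasureTheory.volume c d :=
  Continuous.intervalIntegrable (by fun_prop) _ _

theorem integral_exp_int_mul (k : ℤ) :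
    ∫ θ in (-Real.pi)..Real.pi, Complex.exp (Complex.I * k * θ) =
      if k = 0 then 2 * (Real.pi : ℂ) else 0 := by
  split_ifs with h
  · simp [h]; ring
  · have hk : Complex.I * (k : ℂ) ≠ 0 := mul_ne_zero Complex.I_ne_zero (by exact_mod_cast h)
    rw [integral_exp_mul_complex hk, div_eq_zero_iff, sub_eq_zero]
    left
    rw [Complex.exp_eq_exp_iff_exists_int]
    exact ⟨k, by push_cast; ring⟩

/-- Counting the zeros of an integer valued function by a Fourier integral. -/
theorem card_filter_eq_integral {ι : Type*} [Fintype ι] (u : ι → ℤ) :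
    ((Finset.univ.filter fun w => u w = 0).card : ℂ) =
      1 / (2 * (Real.pi : ℂ)) * ∫ θ in (-Real.pi)..Real.pi,
        ∑ w, Complex.exp (Complex.I * u w * θ) := by
  have hpi : (2 * (Real.pi : ℂ)) ≠ 0 :=
    mul_ne_zero two_ne_zero (by exact_mod_cast Real.pi_ne_zero)
  rw [intervalIntegral.integral_finsetSum fun w _ => intervalIntegrable_exp_int_mul _ _ _]
  simp only [integral_exp_int_mul]
  rw [← Finset.sum_filter, Finset.sum_const, nsmul_eq_mul]
  field_simp

/-- Expanding the power gives one exponential per jump sequence. The arbitrary jump lengths `v`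
serve both the half-unit and the unit scale. -/
theorem exp_mul_sum_pow {a n : ℕ} (v : Fin (a + 1) → ℤ) (x : ℤ) (θ : ℝ) :
    Complex.exp (-(Complex.I * x * θ)) *
        (∑ m, Complex.exp (Complex.I * v m * θ)) ^ n =
      ∑ w : Jumps a n, Complex.exp (Complex.I * ((∑ i, v (w i) - x : ℤ) : ℂ) * θ) := by
  rw [Fintype.sum_pow, Finset.mul_sum]
  refine Finset.sum_congr rfl fun w _ => ?_
  rw [← Complex.exp_sum, ← Complex.exp_add]
  congr 1
  push_cast
  rw [mul_sub, sub_mul, Finset.mul_sum, Finset.sum_mul]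
  ring

theorem RW_eq_integral (a n : ℕ) (x : ℤ) :
    (RW a n x : ℂ) =
      1 / (2 * (Real.pi : ℂ)) * ∫ θ in (-Real.pi)..Real.pi,
        Complex.exp (-(Complex.I * x * θ)) *
          (∑ m ∈ Finset.range (a + 1), Complex.exp (Complex.I * (2 * m - a) * θ)) ^ n := by
  have h : RW a n x =
      (Finset.univ.filter fun w : Jumps a n =>
        ∑ i, (2 * ((w i : ℕ) : ℤ) - a) - x = 0).card := by
    simp only [RW, pos_eq_sum, sub_eq_zero]
  rw [h, card_filter_eq_integral]
  congr 2
  funext θ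
  rw [← exp_mul_sum_pow (fun m : Fin (a + 1) => 2 * ((m : ℕ) : ℤ) - a), ← Fin.sum_univ_eq_sum_range
    fun m : ℕ => Complex.exp (Complex.I * (2 * m - a) * θ)]
  push_cast
  rfl

/-- For `a = 2s` every jump is even, so the walk can be measured in whole units: the frequencies are
halved compared with `RW_eq_integral`. -/
theorem RW_even_eq_integral (s n : ℕ) (j : ℤ) :
    (RW (2 * s) n (2 * j) : ℂ) =
      1 / (2 * (Real.pi : ℂ)) * ∫ θ in (-Real.pi)..Real.pi,
        Complex.exp (-(Complex.I * j * θ)) *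
          (∑ m ∈ Finset.Icc (-(s : ℤ)) s, Complex.exp (Complex.I * m * θ)) ^ n := by
  have h : RW (2 * s) n (2 * j) =
      (Finset.univ.filter fun w : Jumps (2 * s) n =>
        ∑ i, (((w i : ℕ) : ℤ) - s) - j = 0).card := by
    rw [RW]
    congr 1
    ext w
    have : pos w n = 2 * ∑ i, (((w i : ℕ) : ℤ) - s) := by
      rw [pos_eq_sum, Finset.mul_sum]
      refine Finset.sum_congr rfl fun i _ => ?_
      push_cast
      ring
    simp only [Finset.mem_filter, Finset.mem_univ, true_and, this]
    omega
  rw [h, card_filter_eq_integral]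
  congr 2
  funext θ
  rw [← exp_mul_sum_pow (fun m : Fin (2 * s + 1) => ((m : ℕ) : ℤ) - s)]
  congr 2
  rw [Fin.sum_univ_eq_sum_range fun m : ℕ => Complex.exp (Complex.I * (((m : ℤ) - s : ℤ) : ℂ) * θ)]
  refine Finset.sum_nbij' (fun m : ℕ => (m : ℤ) - s) (fun m : ℤ => (m + s).toNat) ?_ ?_ ?_ ?_ ?_
  · intro m hm
    simp only [Finset.mem_range, Finset.mem_Icc] at hm ⊢
    omega
  · intro m hm
    simp only [Finset.mem_range, Finset.mem_Icc] at hm ⊢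
    omega
  · intro m hm
    simp
  · intro m hm
    simp only [Finset.mem_Icc] at hm
    omega
  · intro m hm
    rfl

end SpinWalk

/-- `a = 2s` and `b = 2j`. -/
theorem proposition5 (a n : ℕ) :
    -- degeneracies of the spin representations in the tensor power of the spin-`s` one
    (∀ d : ℕ → ℕ,
      SpinWalk.HasDegeneracies (SpinWalk.tensorPowerRep (SpinWalk.spinRep a) n) d ↔
        ∀ b : ℕ, d b = SpinWalk.RWM a n b) ∧
    -- the walk with a wall in terms of the free walk
    (∀ b : ℕ, (SpinWalk.RWM a n b : ℤ) = (SpinWalk.RW a n b : ℤ) - SpinWalk.RW a n (b + 2)) ∧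
    -- Fourier integral, integer `s`, integer spot `j`
    (∀ s : ℕ, a = 2 * s → ∀ j : ℤ,
      (SpinWalk.RW a n (2 * j) : ℂ) =
        1 / (2 * (Real.pi : ℂ)) * ∫ θ in (-Real.pi)..Real.pi,
          Complex.exp (-(Complex.I * j * θ)) *
            (∑ m ∈ Finset.Icc (-(s : ℤ)) s, Complex.exp (Complex.I * m * θ)) ^ n) ∧
    -- Fourier integral, half-integer `s = a / 2`, any spot `x / 2`
    (Odd a → ∀ x : ℤ,
      (SpinWalk.RW a n x : ℂ) =
        1 / (2 * (Real.pi : ℂ)) * ∫ θ in (-Real.pi)..Real.pi,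
          Complex.exp (-(Complex.I * x * θ)) *
            (∑ m ∈ Finset.range (a + 1),
              Complex.exp (Complex.I * (2 * m - a) * θ)) ^ n) := by
  refine ⟨fun d => ?_, SpinWalk.RWM_eq_RW_sub_RW a n, ?_, fun _ => SpinWalk.RW_eq_integral a n⟩
  · have key : ∀ d : ℕ → ℕ,
        SpinWalk.HasDegeneracies (W := ⨂[ℂ] _i : Fin n, SpinWalk.SpinSpace a)
          (SpinWalk.tensorPowerRep (SpinWalk.spinRep a) n) d → ∀ b : ℕ, d b = SpinWalk.RWM a n b := by
      intro d h b
      have h₁ := h.RW_eq b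
      have h₂ := SpinWalk.RWM_eq_RW_sub_RW a n b
      omega
    refine ⟨key d, fun h => ?_⟩
    obtain ⟨d', hd'⟩ := SpinWalk.IsSpinSum.exists_hasDegeneracies
      (W := ⨂[ℂ] _i : Fin n, SpinWalk.SpinSpace a) (SpinWalk.isSpinSum_tensorPowerRep a n)
    -- Some decomposition exists, and `key` forces its degeneracies to be the prescribed ones.
    obtain rfl : d = d' := funext fun b => (h b).trans (key d' hd' b).symm
    exact hd'
  · rintro s rfl j
    exact SpinWalk.RW_even_eq_integral s n j
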